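/- Let $K$ be a field, $n\ge 0$ and $S=K[x_1,\dots,x_n]$. For a monomial ideal $J$ let $\mathcal{G}(J)$ be its unique minimal set of monomial generators. A nonempty finite set $P\subset\mathbb{Z}_{\ge0}^n$ is a discrete polymatroid if (1) $a\in P$ and $0\le b\le a$ componentwise imply $b\in P$, and (2) for all $a,b\in P$ with $|a|<|b|$ (where $|a|$ is the sum of the entries) there is $i$ with $a_i<b_i$ and $a+e_i\in P$; its bases are its maximal elements for the componentwise order. A monomial ideal generated in a single degree is polymatroidal if it is zero or if the set of exponent vectors of its minimal monomial generators is the set of bases of a discrete polymatroid. A monomial ideal $J$ is componentwise polymatroidal if for every $j\ge 0$ the ideal $J_{\langle j\rangle}$ generated by all homogeneous polynomials of degree $j$ in $J$ is polymatroidal. These notions are used likewise for polynomial rings in a subset of the variables. A monomial ideal is vertex splittable if it is obtained by the following recursive procedure: (a) $0$, the whole ring, and every ideal $(u)$ with $u$ a monomial are vertex splittable; (b) $J\subset S$ is vertex splittable if there are a variable $x_i$ and vertex splittable ideals $J_1\subset S$ and $J_2\subset K[x_1,\dots,x_{i-1},x_{i+1},\dots,x_n]$ such that $J=x_iJ_1+J_2S$,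 $J_2S\subseteq J_1$ and $\mathcal{G}(J)=\mathcal{G}(x_iJ_1)\cup\mathcal{G}(J_2)$. In case (b), $J=x_iJ_1+J_2$ is called a vertex splitting of $J$. Proposition 4.2. Let $I\subset S$ be a componentwise polymatroidal ideal. Then $I$ is vertex splittable. Moreover, for every variable $x_i$ which divides some minimal monomial generator of least degree of $I$, there are ideals $I_1\subset S$ and $I_2\subset K[x_1,\dots,x_{i-1},x_{i+1},\dots,x_n]$ such that $\mathcal{G}(x_iI_1)=\{u\in\mathcal{G}(I): x_i \text{ divides } u\}$, $\mathcal{G}(I_2)=\mathcal{G}(I)\setminus\mathcal{G}(x_iI_1)$, the decomposition $I=x_iI_1+I_2$ is a vertex splitting of $I$, the ideals $x_iI_1$ and $I_1$ are componentwise polymatroidal ideals of $S$, and $I_2$ is a componentwise polymatroidal ideal of $K[x_1,\dots,x_{i-1},x_{i+1},\dots,x_n]$. -/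

import Mathlib

universe u v

open MvPolynomial

section Polymatroid

/-- A discrete polymatroid on the ground set `σ`: a nonempty finite set of vectors in `ℕ^σ` that is
closed under passing to smaller vectors and in which a vector of smaller modulus can be augmented
from a vector of larger modulus. -/
structure IsDiscretePolymatroid {σ : Type v} (P : Set (σ →₀ ℕ)) : Prop where
  nonempty : P.Nonempty
  finite : P.Finite
  down_closed : ∀ a ∈ P, ∀ b ≤ a, b ∈ P
  augment : ∀ a ∈ P, ∀ b ∈ P, a.degree < b.degree →
    ∃ i, a i < b i ∧ a + Finsupp.single i 1 ∈ P

/-- The bases of a discrete polymatroid: its maximal vectors for the componentwise order. -/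
def polymatroidBases {σ : Type v} (P : Set (σ →₀ ℕ)) : Set (σ →₀ ℕ) :=
  {a | Maximal (fun b => b ∈ P) a}

end Polymatroid

section MonomialIdeals

variable {K : Type u} [Field K] {σ : Type v}

/-- A monomial ideal: an ideal generated by a set of monomials. -/
def IsMonomialIdeal (I : Ideal (MvPolynomial σ K)) : Prop :=
  ∃ A : Set (σ →₀ ℕ), I = Ideal.span ((fun a => monomial a (1 : K)) '' A)

/-- `𝒢(I)`, given by exponent vectors: the monomials in `I` that are minimal for divisibility.
For a monomial ideal this is the unique minimal monomial generating set. -/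
def minGens (I : Ideal (MvPolynomial σ K)) : Set (σ →₀ ℕ) :=
  {a | Minimal (fun b => monomial b (1 : K) ∈ I) a}

/-- `I_⟨j⟩`: the ideal generated by the homogeneous polynomials of degree `j` in `I`. -/
noncomputable def idealComponent (I : Ideal (MvPolynomial σ K)) (j : ℕ) : Ideal (MvPolynomial σ K) :=
  Ideal.span {p | p ∈ I ∧ p.IsHomogeneous j}

/-- A monomial ideal generated in a single degree is polymatroidal if the exponent vectors of its
minimal generators are the bases of a discrete polymatroid. As is usual (and needed for the
components of low degree of a nonzero ideal), the zero ideal is polymatroidal. -/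
def IsPolymatroidalIdeal (I : Ideal (MvPolynomial σ K)) : Prop :=
  IsMonomialIdeal I ∧ (∃ d : ℕ, ∀ a ∈ minGens I, a.degree = d) ∧
    (I = ⊥ ∨ ∃ P : Set (σ →₀ ℕ), IsDiscretePolymatroid P ∧ minGens I = polymatroidBases P)

/-- A monomial ideal all of whose components `I_⟨j⟩` are polymatroidal. -/
def IsComponentwisePolymatroidal (I : Ideal (MvPolynomial σ K)) : Prop :=
  IsMonomialIdeal I ∧ ∀ j : ℕ, IsPolymatroidalIdeal (idealComponent I j)

/-- The ideal `x_i I₁` of the polynomial ring. -/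
noncomputable def varMul (i : σ) (I₁ : Ideal (MvPolynomial σ K)) : Ideal (MvPolynomial σ K) :=
  Ideal.span {X i} * I₁

/-- The extension to the polynomial ring in all variables of an ideal of the polynomial ring in the
variables other than `x_i`. -/
noncomputable def extendIdeal {i : σ} (I₂ : Ideal (MvPolynomial {j : σ // j ≠ i} K)) :
    Ideal (MvPolynomial σ K) :=
  I₂.map (rename (Subtype.val : {j : σ // j ≠ i} → σ))

/-- The conditions on a decomposition `I = x_i I₁ + I₂`, with `I₂` an ideal of the polynomial ring in
the variables other than `x_i`: one has `I₂ ⊆ I₁`, and `𝒢(I)` is the union of `𝒢(x_i I₁)` and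
`𝒢(I₂)`. -/
structure IsVariableDecomposition (I : Ideal (MvPolynomial σ K)) (i : σ)
    (I₁ : Ideal (MvPolynomial σ K)) (I₂ : Ideal (MvPolynomial {j : σ // j ≠ i} K)) : Prop where
  eq_add : I = varMul i I₁ + extendIdeal I₂
  le : extendIdeal I₂ ≤ I₁
  minGens_eq : minGens I = minGens (varMul i I₁) ∪ minGens (extendIdeal I₂)

end MonomialIdeals

/-- Vertex splittable ideals. The set of variables is an index, because the second
ideal of a splitting lives in the polynomial ring with one variable fewer. -/
inductive IsVertexSplittable {K : Type u} [Field K] :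
    ∀ {σ : Type v}, Ideal (MvPolynomial σ K) → Prop
  | zero {σ : Type v} : IsVertexSplittable (⊥ : Ideal (MvPolynomial σ K))
  | whole {σ : Type v} : IsVertexSplittable (⊤ : Ideal (MvPolynomial σ K))
  | principal {σ : Type v} (a : σ →₀ ℕ) :
      IsVertexSplittable (Ideal.span {monomial a (1 : K)})
  | split {σ : Type v} (I : Ideal (MvPolynomial σ K)) (i : σ)
      (I₁ : Ideal (MvPolynomial σ K)) (I₂ : Ideal (MvPolynomial {j : σ // j ≠ i} K))
      (h₁ : IsVertexSplittable I₁) (h₂ : IsVertexSplittable I₂)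
      (h : IsVariableDecomposition I i I₁ I₂) : IsVertexSplittable I

/-- `I = x_i I₁ + I₂` is a vertex splitting of `I`. -/
def IsVertexSplitting {K : Type u} [Field K] {σ : Type v} (I : Ideal (MvPolynomial σ K)) (i : σ)
    (I₁ : Ideal (MvPolynomial σ K)) (I₂ : Ideal (MvPolynomial {j : σ // j ≠ i} K)) : Prop :=
  IsVertexSplittable I₁ ∧ IsVertexSplittable I₂ ∧ IsVariableDecomposition I i I₁ I₂

/-! ### Exchange properties and discrete polymatroids. -/

section Exchange

variable {σ : Type v}

/-! Being componentwise polymatroidal amounts to an exchange property for the exponent vectors of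
each degree (`isComponentwisePolymatroidal_iff`). Take `I₁ = I : x_i` (`colonVar`), so that `x_i I₁`
is spanned by the monomials of `I` divisible by `x_i`, and let `I₂` (`restrictVar`) be spanned by
those free of `x_i`. Exchange passes to all three ideals. The delicate point is that minimal
generators of `x_i I₁` stay minimal in `I` (`minGens_varMul_colonVar`); this uses a generator of
least degree divisible by `x_i`. Splittability follows by induction on the number of variables and,
for a fixed number, Noetherian induction along `I < I : x_i`. -/

/-- The exchange property of the bases of a discrete polymatroid. -/
def HasExchange (B : Set (σ →₀ ℕ)) : Prop :=
  ∀ u ∈ B, ∀ w ∈ B, ∀ k, w k < u k →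
    ∃ l, u l < w l ∧ u - Finsupp.single k 1 + Finsupp.single l 1 ∈ B

/-- Exchanging `u` towards `w` lowers their distance; this makes the inductions below terminate. -/
theorem degree_exchange_tsub {u w : σ →₀ ℕ} {k l : σ} (hk : w k < u k) (hl : u l < w l) :
    (u - Finsupp.single k 1 + Finsupp.single l 1 - w).degree + 1 = (u - w).degree := by
  classical
  have h : u - Finsupp.single k 1 + Finsupp.single l 1 - w + Finsupp.single k 1 = u - w := by
    ext x
    simp only [Finsupp.add_apply, Finsupp.tsub_apply, Finsupp.single_apply]
    split_ifs <;> subst_vars <;> omega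
  rw [← h, map_add, Finsupp.degree_single]

/-- A weak form of the dual exchange property. -/
theorem HasExchange.exists_le_add_single {B : Set (σ →₀ ℕ)} (hB : HasExchange B) {u : σ →₀ ℕ}
    (hu : u ∈ B) {i : σ} {w : σ →₀ ℕ} (hw : w ∈ B) (hi : u i < w i) :
    ∃ b ∈ B, u i < b i ∧ b ≤ u + Finsupp.single i 1 := by
  classical
  induction hn : (w - u).degree using Nat.strong_induction_on generalizing w with
  | _ n ih =>
    by_cases hle : w ≤ u + Finsupp.single i 1
    · exact ⟨w, hw, hi, hle⟩
    obtain ⟨k, hk⟩ : ∃ k, (u + Finsupp.single i 1 : σ →₀ ℕ) k < w k := by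
      by_contra! h
      exact hle h
    simp only [Finsupp.add_apply, Finsupp.single_apply] at hk
    have hk' : u k < w k := by omega
    obtain ⟨l, hl, hm⟩ := hB w hw u hu k hk'
    have hdeg := degree_exchange_tsub hk' hl
    -- Coordinate `i` stays above `u i`: `l ≠ i` because `w l < u l`, and if `k = i` then `w i`
    -- exceeds `u i + 1`.
    refine ih _ (by omega) hm ?_ rfl
    simp only [Finsupp.add_apply, Finsupp.tsub_apply, Finsupp.single_apply]
    split_ifs at hk ⊢ <;> subst_vars <;> first | omega | contradiction

theorem degree_tsub_of_le {a u : σ →₀ ℕ} (h : a ≤ u) : (u - a).degree + a.degree = u.degree := by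
  rw [← map_add, tsub_add_cancel_of_le h]

theorem eq_of_le_of_degree_eq {a b : σ →₀ ℕ} (h : a ≤ b) (hd : a.degree = b.degree) : a = b := by
  have h1 := degree_tsub_of_le h
  exact le_antisymm h (tsub_eq_zero_iff_le.1 ((Finsupp.degree_eq_zero_iff _).1 (by omega)))

/-- Move `u` towards `w` while keeping `a ≤ u`. If no augmentation exists, `u` agrees with `a`
wherever `a i < b i`. As `u` and `w` have equal degree, `u - a` exceeds `w - b` at some `k`; there
`b k ≤ a k`, so `w k < u k` and `u` can give up a unit at `k`. -/
theorem HasExchange.augment {B : Set (σ →₀ ℕ)} (hB : HasExchange B) {d : ℕ}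
    (hd : ∀ u ∈ B, u.degree = d) {a b u w : σ →₀ ℕ} (hu : u ∈ B) (hau : a ≤ u) (hw : w ∈ B)
    (hbw : b ≤ w) (hab : a.degree < b.degree) :
    ∃ i, a i < b i ∧ ∃ c ∈ B, a + Finsupp.single i 1 ≤ c := by
  classical
  induction hn : (u - w).degree using Nat.strong_induction_on generalizing u with
  | _ n ih =>
    by_contra! hno
    have hfix : ∀ i, a i < b i → u i = a i := by
      intro i hi
      by_contra hne
      refine hno i hi u hu fun x => ?_
      have := hau x
      simp only [Finsupp.add_apply, Finsupp.single_apply]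
      split_ifs <;> subst_vars <;> omega
    obtain ⟨k, hk⟩ : ∃ k, (w - b) k < (u - a) k := by
      by_contra! h
      have := Finsupp.degree_mono (show u - a ≤ w - b from h)
      have h1 := degree_tsub_of_le hau
      have h2 := degree_tsub_of_le hbw
      rw [hd _ hu] at h1
      rw [hd _ hw] at h2
      omega
    simp only [Finsupp.tsub_apply] at hk
    have hfk := hfix k
    have hbk := hbw k
    have hak := hau k
    have hk' : w k < u k := by
      by_cases h : a k < b k
      · have := hfk h
        omega
      · omega
    obtain ⟨l, hl, hm⟩ := hB u hu w hw k hk'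
    have hdeg := degree_exchange_tsub hk' hl
    obtain ⟨i, hi, c, hc, hle⟩ := ih _ (by omega) hm (fun x => by
      have := hau x
      simp only [Finsupp.add_apply, Finsupp.tsub_apply, Finsupp.single_apply]
      split_ifs <;> subst_vars <;> omega) rfl
    exact hno i hi c hc hle

/-- The sets of bases of discrete polymatroids are the nonempty sets of vectors of constant modulus
with the exchange property. -/
theorem hasExchange_iff_polymatroidBases [Finite σ] {B : Set (σ →₀ ℕ)} {d : ℕ}
    (hd : ∀ u ∈ B, u.degree = d) (hne : B.Nonempty) :
    HasExchange B ↔ ∃ P, IsDiscretePolymatroid P ∧ B = polymatroidBases P := by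
  classical
  constructor
  · intro hB
    refine ⟨{a | ∃ u ∈ B, a ≤ u}, ⟨?_, ?_, ?_, ?_⟩, ?_⟩
    · obtain ⟨u, hu⟩ := hne
      exact ⟨u, u, hu, le_rfl⟩
    · refine (Finsupp.finite_of_degree_le d).subset ?_
      rintro a ⟨u, hu, hau⟩
      exact (Finsupp.degree_mono hau).trans (hd u hu).le
    · rintro a ⟨u, hu, hau⟩ b hba
      exact ⟨u, hu, hba.trans hau⟩
    · rintro a ⟨u, hu, hau⟩ b ⟨w, hw, hbw⟩ hab
      exact hB.augment hd hu hau hw hbw hab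
    · ext u
      constructor
      · intro hu
        refine ⟨⟨u, hu, le_rfl⟩, ?_⟩
        rintro b ⟨w, hw, hbw⟩ hub
        rwa [eq_of_le_of_degree_eq (hub.trans hbw) ((hd u hu).trans (hd w hw).symm)]
      · rintro ⟨⟨w, hw, huw⟩, hmax⟩
        exact (le_antisymm huw (hmax ⟨w, hw, le_rfl⟩ huw)) ▸ hw
  · rintro ⟨P, hP, rfl⟩ u hu w hw k hk
    have hle : Finsupp.single k 1 ≤ u := Finsupp.single_le_iff.2 (by omega)
    have h1 := degree_tsub_of_le hle
    rw [hd u hu, Finsupp.degree_single] at h1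
    obtain ⟨l, hl, hm⟩ := hP.augment (u - Finsupp.single k 1)
      (hP.down_closed u hu.1 _ tsub_le_self) w hw.1 (by rw [hd w hw]; omega)
    have hlk : u l < w l := by
      simp only [Finsupp.tsub_apply, Finsupp.single_apply] at hl
      split_ifs at hl <;> subst_vars <;> omega
    refine ⟨l, hlk, hm, ?_⟩
    -- Finiteness puts `c` below a base, and all bases have degree `d`, which the exchanged vector
    -- already has.
    intro c hc hle'
    obtain ⟨m, hcm, hmax⟩ := hP.finite.exists_le_maximal hc
    rwa [eq_of_le_of_degree_eq (hle'.trans hcm)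
      (by rw [hd m hmax, map_add, Finsupp.degree_single]; exact h1)]

end Exchange

/-! ### Monomial ideals and their graded components. -/

section Monomials

variable {K : Type u} [Field K] {σ : Type v}

theorem monomial_mem_span_iff {A : Set (σ →₀ ℕ)} {b : σ →₀ ℕ} :
    monomial b (1 : K) ∈ Ideal.span ((fun a => monomial a (1 : K)) '' A) ↔ ∃ a ∈ A, a ≤ b := by
  classical
  rw [mem_ideal_span_monomial_image, support_monomial, if_neg one_ne_zero]
  simp

theorem monomial_mem_of_le {I : Ideal (MvPolynomial σ K)} {a b : σ →₀ ℕ}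
    (ha : monomial a (1 : K) ∈ I) (h : a ≤ b) : monomial b (1 : K) ∈ I :=
  I.mem_of_dvd (monomial_dvd_monomial.2 ⟨Or.inr h, dvd_rfl⟩) ha

theorem isMonomialIdeal_span (A : Set (σ →₀ ℕ)) :
    IsMonomialIdeal (Ideal.span ((fun a => monomial a (1 : K)) '' A)) :=
  ⟨A, rfl⟩

theorem IsMonomialIdeal.mem_iff {I : Ideal (MvPolynomial σ K)} (hI : IsMonomialIdeal I)
    {p : MvPolynomial σ K} : p ∈ I ↔ ∀ a ∈ p.support, monomial a (1 : K) ∈ I := by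
  obtain ⟨A, rfl⟩ := hI
  exact mem_ideal_span_monomial_image.trans (by simp only [monomial_mem_span_iff])

theorem IsMonomialIdeal.le_iff {I J : Ideal (MvPolynomial σ K)} (hI : IsMonomialIdeal I) :
    I ≤ J ↔ ∀ a, monomial a (1 : K) ∈ I → monomial a (1 : K) ∈ J := by
  refine ⟨fun h a ha => h ha, fun h => ?_⟩
  obtain ⟨A, rfl⟩ := hI
  refine Ideal.span_le.2 ?_
  rintro _ ⟨a, ha, rfl⟩
  exact h a (Ideal.subset_span ⟨a, ha, rfl⟩)

theorem exists_minGens_le {I : Ideal (MvPolynomial σ K)} {b : σ →₀ ℕ}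
    (hb : monomial b (1 : K) ∈ I) : ∃ a ∈ minGens I, a ≤ b := by
  induction hn : b.degree using Nat.strong_induction_on generalizing b with
  | _ n ih =>
    by_cases h : b ∈ minGens I
    · exact ⟨b, h, le_rfl⟩
    · obtain ⟨c, hcb, hc⟩ : ∃ c, c < b ∧ monomial c (1 : K) ∈ I := by
        by_contra! hno
        refine h ⟨hb, fun c hc hcb => ?_⟩
        by_contra hbc
        exact hno c (lt_of_le_not_ge hcb hbc) hc
      have hlt : c.degree < b.degree := by
        refine lt_of_le_of_ne (Finsupp.degree_mono hcb.le) fun he => hcb.ne ?_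
        exact eq_of_le_of_degree_eq hcb.le he
      obtain ⟨a, ha, hac⟩ := ih _ (hn ▸ hlt) hc rfl
      exact ⟨a, ha, hac.trans hcb.le⟩

/-- The exponent vectors of the monomials of degree `j` in `I`. -/
def degreePart (I : Ideal (MvPolynomial σ K)) (j : ℕ) : Set (σ →₀ ℕ) :=
  {a | monomial a (1 : K) ∈ I ∧ a.degree = j}

theorem IsMonomialIdeal.idealComponent_eq {I : Ideal (MvPolynomial σ K)} (hI : IsMonomialIdeal I)
    (j : ℕ) : idealComponent I j =
      Ideal.span ((fun a => monomial a (1 : K)) '' degreePart I j) := by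
  refine le_antisymm (Ideal.span_le.2 ?_) (Ideal.span_le.2 ?_)
  · rintro p ⟨hp, hj⟩
    refine mem_ideal_span_monomial_image.2 fun a ha => ⟨a, ⟨hI.mem_iff.1 hp a ha, ?_⟩, le_rfl⟩
    rw [Finsupp.degree_eq_weight_one]
    exact hj (mem_support_iff.1 ha)
  · rintro _ ⟨a, ha, rfl⟩
    exact Ideal.subset_span ⟨ha.1, isHomogeneous_monomial _ ha.2⟩

theorem IsMonomialIdeal.minGens_idealComponent {I : Ideal (MvPolynomial σ K)}
    (hI : IsMonomialIdeal I) (j : ℕ) : minGens (idealComponent I j) = degreePart I j := by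
  ext b
  simp only [minGens, hI.idealComponent_eq, monomial_mem_span_iff]
  constructor
  · rintro ⟨⟨a, ha, hab⟩, hmin⟩
    rwa [le_antisymm (hmin ⟨a, ha, le_rfl⟩ hab) hab]
  · intro hb
    refine ⟨⟨b, hb, le_rfl⟩, ?_⟩
    rintro c ⟨a, ha, hac⟩ hcb
    rwa [← eq_of_le_of_degree_eq (hac.trans hcb) (ha.2.trans hb.2.symm)]

/-- An empty degree part gives the zero component, where exchange is vacuous; otherwise the degree
part is the set of minimal generators of the component. -/
theorem isComponentwisePolymatroidal_iff [Finite σ] {I : Ideal (MvPolynomial σ K)} :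
    IsComponentwisePolymatroidal I ↔ IsMonomialIdeal I ∧ ∀ j, HasExchange (degreePart I j) := by
  refine and_congr_right fun hI => forall_congr' fun j => ?_
  have hd : ∀ a ∈ degreePart I j, a.degree = j := fun a ha => ha.2
  have hmon : IsMonomialIdeal (idealComponent I j) := ⟨_, hI.idealComponent_eq j⟩
  rcases (degreePart I j).eq_empty_or_nonempty with he | hne
  · refine iff_of_true ⟨hmon, ⟨j, ?_⟩, Or.inl ?_⟩ ?_
    · rwa [hI.minGens_idealComponent]
    · rw [hI.idealComponent_eq, he, Set.image_empty, Ideal.span_empty]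
    · rw [he]
      exact fun u hu => hu.elim
  · rw [IsPolymatroidalIdeal, hI.minGens_idealComponent, hasExchange_iff_polymatroidBases hd hne]
    constructor
    · rintro ⟨-, -, h0 | h⟩
      · obtain ⟨a, ha⟩ := hne
        have : monomial a (1 : K) ∈ idealComponent I j := by
          rw [hI.idealComponent_eq]
          exact Ideal.subset_span ⟨a, ha, rfl⟩
        rw [h0, Ideal.mem_bot, monomial_eq_zero] at this
        exact (one_ne_zero this).elim
      · exact h
    · exact fun h => ⟨hmon, ⟨j, hd⟩, Or.inr h⟩

end Monomials

/-! ### The colon and restriction ideals. -/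

section Splitting

variable {K : Type u} [Field K] {σ : Type v}

/-- The monomial ideal with monomials those `a` for which `x_i a` is in `I`. -/
noncomputable def colonVar (I : Ideal (MvPolynomial σ K)) (i : σ) : Ideal (MvPolynomial σ K) :=
  Ideal.span ((fun a => monomial a (1 : K)) '' {a | monomial (a + Finsupp.single i 1) (1 : K) ∈ I})

/-- The monomial ideal generated by the monomials of `I` in the variables other than `x_i`. -/
noncomputable def restrictVar (I : Ideal (MvPolynomial σ K)) (i : σ) :
    Ideal (MvPolynomial {j : σ // j ≠ i} K) :=
  Ideal.span ((fun a => monomial a (1 : K)) ''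
    {c | monomial (c.mapDomain Subtype.val) (1 : K) ∈ I})

variable {I : Ideal (MvPolynomial σ K)} {i : σ}

theorem monomial_mem_colonVar {a : σ →₀ ℕ} :
    monomial a (1 : K) ∈ colonVar I i ↔ monomial (a + Finsupp.single i 1) (1 : K) ∈ I := by
  rw [colonVar, monomial_mem_span_iff]
  constructor
  · rintro ⟨b, hb, hba⟩
    exact monomial_mem_of_le hb (add_le_add_left hba _)
  · exact fun h => ⟨a, h, le_rfl⟩

theorem varMul_colonVar : varMul i (colonVar I i) =
    Ideal.span ((fun a => monomial a (1 : K)) '' {b | monomial b (1 : K) ∈ I ∧ b i ≠ 0}) := by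
  classical
  rw [varMul, colonVar, Ideal.span_mul_span']
  congr 1
  ext p
  simp only [Set.singleton_mul, Set.mem_image, Set.mem_ofPred_eq]
  constructor
  · rintro ⟨_, ⟨a, ha, rfl⟩, rfl⟩
    exact ⟨a + Finsupp.single i 1, ⟨ha, by simp⟩, by rw [X, monomial_mul, one_mul, add_comm]⟩
  · rintro ⟨b, ⟨hb, hbi⟩, rfl⟩
    have hle : Finsupp.single i 1 ≤ b := Finsupp.single_le_iff.2 (Nat.one_le_iff_ne_zero.2 hbi)
    refine ⟨_, ⟨b - Finsupp.single i 1, by rwa [tsub_add_cancel_of_le hle], rfl⟩, ?_⟩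
    rw [X, monomial_mul, one_mul, add_tsub_cancel_of_le hle]

theorem monomial_mem_varMul_colonVar {b : σ →₀ ℕ} :
    monomial b (1 : K) ∈ varMul i (colonVar I i) ↔ monomial b (1 : K) ∈ I ∧ b i ≠ 0 := by
  rw [varMul_colonVar, monomial_mem_span_iff]
  constructor
  · rintro ⟨a, ⟨ha, hai⟩, hab⟩
    exact ⟨monomial_mem_of_le ha hab, (Nat.pos_of_ne_zero hai |>.trans_le (hab i)).ne'⟩
  · exact fun h => ⟨b, h, le_rfl⟩

theorem mapDomain_val_apply_self (c : {j : σ // j ≠ i} →₀ ℕ) :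
    c.mapDomain Subtype.val i = 0 :=
  Finsupp.mapDomain_of_notMem_range _ _ (by simp)

theorem exists_mapDomain_val_eq {b : σ →₀ ℕ} (hb : b i = 0) :
    ∃ c : {j : σ // j ≠ i} →₀ ℕ, c.mapDomain Subtype.val = b := by
  refine ⟨_, Finsupp.mapDomain_comapDomain _ Subtype.val_injective b ?_⟩
  intro j hj
  refine ⟨⟨j, ?_⟩, rfl⟩
  rintro rfl
  exact Finsupp.mem_support_iff.1 hj hb

theorem mapDomain_val_le {c d : {j : σ // j ≠ i} →₀ ℕ} (h : c ≤ d) :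
    c.mapDomain Subtype.val ≤ d.mapDomain Subtype.val := by
  rw [← tsub_add_cancel_of_le h, Finsupp.mapDomain_add]
  exact le_add_self

theorem monomial_mem_restrictVar {c : {j : σ // j ≠ i} →₀ ℕ} :
    monomial c (1 : K) ∈ restrictVar I i ↔ monomial (c.mapDomain Subtype.val) (1 : K) ∈ I := by
  rw [restrictVar, monomial_mem_span_iff]
  constructor
  · rintro ⟨b, hb, hbc⟩
    exact monomial_mem_of_le hb (mapDomain_val_le hbc)
  · exact fun h => ⟨c, h, le_rfl⟩

theorem extendIdeal_restrictVar : extendIdeal (restrictVar I i) =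
    Ideal.span ((fun a => monomial a (1 : K)) '' {b | monomial b (1 : K) ∈ I ∧ b i = 0}) := by
  rw [extendIdeal, restrictVar, Ideal.map_span]
  congr 1
  ext p
  simp only [Set.mem_image, Set.mem_ofPred_eq]
  constructor
  · rintro ⟨_, ⟨c, hc, rfl⟩, rfl⟩
    exact ⟨_, ⟨hc, mapDomain_val_apply_self c⟩, by rw [rename_monomial]⟩
  · rintro ⟨b, ⟨hb, hbi⟩, rfl⟩
    obtain ⟨c, rfl⟩ := exists_mapDomain_val_eq hbi
    exact ⟨_, ⟨c, hb, rfl⟩, by rw [rename_monomial]⟩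

/-- Divisors of a monomial free of `x_i` are free of `x_i`, so minimality is the same in both
ideals. -/
theorem minGens_extendIdeal_restrictVar :
    minGens (extendIdeal (restrictVar I i)) = {b ∈ minGens I | b i = 0} := by
  ext b
  simp only [minGens, extendIdeal_restrictVar, monomial_mem_span_iff]
  constructor
  · rintro ⟨⟨a, ha, hab⟩, hmin⟩
    obtain rfl := le_antisymm (hmin ⟨a, ha, le_rfl⟩ hab) hab
    refine ⟨⟨ha.1, fun c hc hca => ?_⟩, ha.2⟩
    exact hmin ⟨c, ⟨hc, Nat.le_zero.1 ((hca i).trans ha.2.le)⟩, le_rfl⟩ hca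
  · rintro ⟨⟨hb, hmin⟩, hbi⟩
    refine ⟨⟨b, ⟨hb, hbi⟩, le_rfl⟩, ?_⟩
    rintro c ⟨a, ha, hac⟩ hcb
    exact hmin (monomial_mem_of_le ha.1 hac) hcb

theorem minGens_varMul_colonVar (hI : ∀ j, HasExchange (degreePart I j)) {a : σ →₀ ℕ}
    (ha : a ∈ minGens I) (hmin : ∀ b ∈ minGens I, a.degree ≤ b.degree) (hai : a i ≠ 0) :
    minGens (varMul i (colonVar I i)) = {b ∈ minGens I | b i ≠ 0} := by
  classical
  ext b
  simp only [minGens, monomial_mem_varMul_colonVar]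
  constructor
  · rintro ⟨⟨hb, hbi⟩, hbmin⟩
    refine ⟨⟨hb, fun c hc hcb => ?_⟩, hbi⟩
    by_cases hci : c i = 0
    · exfalso
      obtain ⟨g, hg, hgc⟩ := exists_minGens_le hc
      have hac : a.degree ≤ c.degree := (hmin g hg).trans (Finsupp.degree_mono hgc)
      -- Least degree of `a` allows padding it by powers of `x_i` up to the degree of `c`. Exchange
      -- then yields `w ≤ c + e_i ≤ b` in `I`, divisible by `x_i`; minimality forces `w = b`, hence
      -- `c = b`, although `c i = 0`.
      obtain ⟨w, hw, hci', hwc⟩ := (hI c.degree).exists_le_add_single (u := c) ⟨hc, rfl⟩ (i := i)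
        (w := a + Finsupp.single i (c.degree - a.degree))
        ⟨monomial_mem_of_le ha.1 le_self_add, by
          rw [map_add, Finsupp.degree_single]; omega⟩
        (by simp only [Finsupp.add_apply, Finsupp.single_eq_same]; omega)
      have hwb : w ≤ b := by
        intro x
        have h1 := hwc x
        have h2 := hcb x
        simp only [Finsupp.add_apply, Finsupp.single_apply] at h1
        split_ifs at h1 <;> subst_vars <;> omega
      have hbw := hbmin ⟨hw.1, by omega⟩ hwb
      have hdeg : c.degree = b.degree := by
        rw [← le_antisymm hwb hbw, hw.2]
      rw [← eq_of_le_of_degree_eq hcb hdeg] at hbi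
      exact hbi hci
    · exact hbmin ⟨hc, hci⟩ hcb
  · rintro ⟨⟨hb, hbmin⟩, hbi⟩
    exact ⟨⟨hb, hbi⟩, fun c hc hcb => hbmin hc.1 hcb⟩

theorem isVariableDecomposition_colonVar (hI : IsMonomialIdeal I)
    (hg : minGens (varMul i (colonVar I i)) = {b ∈ minGens I | b i ≠ 0}) :
    IsVariableDecomposition I i (colonVar I i) (restrictVar I i) where
  eq_add := by
    rw [varMul_colonVar, extendIdeal_restrictVar]
    refine le_antisymm (hI.le_iff.2 fun a ha => ?_) (sup_le (Ideal.span_le.2 ?_)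
      (Ideal.span_le.2 ?_))
    · by_cases hai : a i = 0
      · exact Ideal.mem_sup_right (Ideal.subset_span ⟨a, ⟨ha, hai⟩, rfl⟩)
      · exact Ideal.mem_sup_left (Ideal.subset_span ⟨a, ⟨ha, hai⟩, rfl⟩)
    · rintro _ ⟨a, ha, rfl⟩
      exact ha.1
    · rintro _ ⟨a, ha, rfl⟩
      exact ha.1
  le := by
    rw [extendIdeal_restrictVar]
    refine Ideal.span_le.2 ?_
    rintro _ ⟨a, ha, rfl⟩
    exact monomial_mem_colonVar.2 (monomial_mem_of_le ha.1 le_self_add)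
  minGens_eq := by
    rw [hg, minGens_extendIdeal_restrictVar]
    ext b
    by_cases h : b i = 0 <;> simp [h]

theorem IsComponentwisePolymatroidal.colonVar [Finite σ] (hI : IsComponentwisePolymatroidal I)
    (i : σ) : IsComponentwisePolymatroidal (colonVar I i) := by
  classical
  rw [isComponentwisePolymatroidal_iff] at hI ⊢
  refine ⟨isMonomialIdeal_span _, fun j u hu w hw k hk => ?_⟩
  simp only [degreePart, Set.mem_ofPred_eq, monomial_mem_colonVar] at hu hw ⊢
  obtain ⟨l, hl, hm, hd⟩ := hI.2 (j + 1) (u + Finsupp.single i 1)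
    ⟨hu.1, by rw [map_add, Finsupp.degree_single, hu.2]⟩ (w + Finsupp.single i 1)
    ⟨hw.1, by rw [map_add, Finsupp.degree_single, hw.2]⟩ k (by simpa using hk)
  have he : u + Finsupp.single i 1 - Finsupp.single k 1 + Finsupp.single l 1 =
      u - Finsupp.single k 1 + Finsupp.single l 1 + Finsupp.single i 1 := by
    ext x
    simp only [Finsupp.add_apply, Finsupp.tsub_apply, Finsupp.single_apply]
    split_ifs <;> subst_vars <;> omega
  rw [he] at hm hd
  refine ⟨l, by simpa using hl, hm, ?_⟩
  rw [map_add, Finsupp.degree_single] at hd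
  omega

theorem IsComponentwisePolymatroidal.varMul_colonVar [Finite σ]
    (hI : IsComponentwisePolymatroidal I) (i : σ) :
    IsComponentwisePolymatroidal (varMul i (_root_.colonVar I i)) := by
  classical
  rw [isComponentwisePolymatroidal_iff] at hI ⊢
  refine ⟨⟨_, _root_.varMul_colonVar⟩, fun j u hu w hw k hk => ?_⟩
  simp only [degreePart, Set.mem_ofPred_eq, monomial_mem_varMul_colonVar] at hu hw ⊢
  obtain ⟨l, hl, hm, hd⟩ := hI.2 j u ⟨hu.1.1, hu.2⟩ w ⟨hw.1.1, hw.2⟩ k hk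
  -- If `k = i`, then `u i > w i ≥ 1`, so a factor `x_i` survives the exchange.
  refine ⟨l, hl, ⟨hm, ?_⟩, hd⟩
  have h1 := hu.1.2
  have h2 := hw.1.2
  simp only [Finsupp.add_apply, Finsupp.tsub_apply, Finsupp.single_apply]
  split_ifs <;> subst_vars <;> omega

theorem IsComponentwisePolymatroidal.restrictVar [Finite σ]
    (hI : IsComponentwisePolymatroidal I) (i : σ) :
    IsComponentwisePolymatroidal (restrictVar I i) := by
  classical
  rw [isComponentwisePolymatroidal_iff] at hI ⊢
  refine ⟨isMonomialIdeal_span _, fun j u hu w hw k hk => ?_⟩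
  simp only [degreePart, Set.mem_ofPred_eq, monomial_mem_restrictVar] at hu hw ⊢
  have happ (c : {j : σ // j ≠ i} →₀ ℕ) (x : {j : σ // j ≠ i}) :
      c.mapDomain Subtype.val x.1 = c x := Finsupp.mapDomain_apply Subtype.val_injective c x
  obtain ⟨l, hl, hm, hd⟩ := hI.2 j (u.mapDomain Subtype.val)
    ⟨hu.1, by rw [Finsupp.degree_mapDomain, hu.2]⟩ (w.mapDomain Subtype.val)
    ⟨hw.1, by rw [Finsupp.degree_mapDomain, hw.2]⟩ k.1 (by rwa [happ, happ])
  -- The exchange cannot introduce `x_i`, since the target vector vanishes at `i`.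
  have hli : l ≠ i := by
    rintro rfl
    simp only [mapDomain_val_apply_self] at hl
    omega
  lift l to {j : σ // j ≠ i} using hli
  have he : u.mapDomain Subtype.val - Finsupp.single k.1 1 + Finsupp.single l.1 1 =
      (u - Finsupp.single k 1 + Finsupp.single l 1).mapDomain Subtype.val := by
    have hle : Finsupp.single k 1 ≤ u := Finsupp.single_le_iff.2 (by omega)
    conv_lhs => rw [← tsub_add_cancel_of_le hle]
    simp only [Finsupp.mapDomain_add, Finsupp.mapDomain_single, add_tsub_cancel_right]
  rw [he] at hm hd
  rw [Finsupp.degree_mapDomain] at hd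
  exact ⟨l, by rwa [happ, happ] at hl, hm, hd⟩

theorem exists_minGens_degree_le {I : Ideal (MvPolynomial σ K)} (hI : IsMonomialIdeal I)
    (h0 : I ≠ ⊥) : ∃ a ∈ minGens I, ∀ b ∈ minGens I, a.degree ≤ b.degree := by
  have hne : (minGens I).Nonempty := by
    by_contra! h
    refine h0 (le_bot_iff.1 (hI.le_iff.2 fun a ha => ?_))
    obtain ⟨b, hb, -⟩ := exists_minGens_le ha
    rw [h] at hb
    exact hb.elim
  obtain ⟨a, ha, h⟩ := (measure fun a : σ →₀ ℕ => a.degree).wf.has_min (minGens I) hne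
  exact ⟨a, ha, fun b hb => not_lt.1 (h b hb)⟩

/-- Strict because `a - e_i` lies in the colon ideal but, by minimality of `a`, not in `I`. -/
theorem lt_colonVar (hI : IsMonomialIdeal I) {a : σ →₀ ℕ} (ha : a ∈ minGens I) (hai : a i ≠ 0) :
    I < colonVar I i := by
  refine lt_of_le_not_ge (hI.le_iff.2 fun b hb =>
    monomial_mem_colonVar.2 (monomial_mem_of_le hb le_self_add)) fun h => ?_
  have hle : Finsupp.single i 1 ≤ a := Finsupp.single_le_iff.2 (Nat.one_le_iff_ne_zero.2 hai)
  have hmem : monomial (a - Finsupp.single i 1) (1 : K) ∈ I :=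
    h (monomial_mem_colonVar.2 (by rw [tsub_add_cancel_of_le hle]; exact ha.1))
  have := ha.2 hmem tsub_le_self i
  simp only [Finsupp.tsub_apply, Finsupp.single_eq_same] at this
  omega

end Splitting

/-! ### Vertex splittability and the main result. -/

theorem IsComponentwisePolymatroidal.isVertexSplittable {K : Type u} [Field K] {σ : Type v}
    [Finite σ] {I : Ideal (MvPolynomial σ K)} (hI : IsComponentwisePolymatroidal I) :
    IsVertexSplittable I := by
  induction hn : Nat.card σ using Nat.strong_induction_on generalizing σ with
  | _ n ihσ =>
    -- The colon ideal keeps all variables but is strictly larger; the restriction loses a variable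
    -- and falls under the outer induction.
    induction I using WellFoundedGT.induction with
    | ind I ih =>
      have hI' := isComponentwisePolymatroidal_iff.1 hI
      by_cases h0 : I = ⊥
      · exact h0 ▸ .zero
      obtain ⟨a, ha, hmin⟩ := exists_minGens_degree_le hI.1 h0
      by_cases ha0 : a = 0
      · have htop : I = ⊤ := (Ideal.eq_top_iff_one I).2 (by simpa [ha0] using ha.1)
        exact htop ▸ .whole
      obtain ⟨i, hai⟩ := Finsupp.ne_iff.1 ha0
      have hcard : Nat.card {j : σ // j ≠ i} < n := by
        rw [← hn]
        exact Finite.card_subtype_lt (x := i) (by simp)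
      exact .split I i _ _ (ih _ (lt_colonVar hI.1 ha hai) (hI.colonVar i))
        (ihσ _ hcard (hI.restrictVar i) rfl)
        (isVariableDecomposition_colonVar hI.1 (minGens_varMul_colonVar hI'.2 ha hmin hai))

theorem proposition4p2 {K : Type u} [Field K] {σ : Type v} [Finite σ]
    (I : Ideal (MvPolynomial σ K)) (hI : IsComponentwisePolymatroidal I) :
    IsVertexSplittable I ∧
      ∀ (i : σ) (a : σ →₀ ℕ), a ∈ minGens I → (∀ b ∈ minGens I, a.degree ≤ b.degree) →
        (X i : MvPolynomial σ K) ∣ monomial a (1 : K) →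
        ∃ (I₁ : Ideal (MvPolynomial σ K)) (I₂ : Ideal (MvPolynomial {j : σ // j ≠ i} K)),
          IsVertexSplitting I i I₁ I₂ ∧
          minGens (varMul i I₁) =
            {b ∈ minGens I | (X i : MvPolynomial σ K) ∣ monomial b (1 : K)} ∧
          minGens (extendIdeal I₂) = minGens I \ minGens (varMul i I₁) ∧
          IsComponentwisePolymatroidal (varMul i I₁) ∧
          IsComponentwisePolymatroidal I₁ ∧
          IsComponentwisePolymatroidal I₂ := by
  refine ⟨hI.isVertexSplittable, fun i a ha hmin hdvd => ?_⟩
  have hai : a i ≠ 0 := (X_dvd_monomial.1 hdvd).resolve_left one_ne_zero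
  have hg := minGens_varMul_colonVar (isComponentwisePolymatroidal_iff.1 hI).2 ha hmin hai
  refine ⟨colonVar I i, restrictVar I i, ⟨(hI.colonVar i).isVertexSplittable,
    (hI.restrictVar i).isVertexSplittable, isVariableDecomposition_colonVar hI.1 hg⟩, ?_, ?_,
    hI.varMul_colonVar i, hI.colonVar i, hI.restrictVar i⟩
  · simp only [hg, X_dvd_monomial, one_ne_zero, false_or]
  · rw [hg, minGens_extendIdeal_restrictVar]
    ext b
    by_cases h : b i = 0 <;> simp [h]
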